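/- Let $n\ge 1$ be an integer and let $(\mathcal C,\mathbb E,\mathfrak s)$ be a skeletally small $n$-exangulated category in the sense of Herschend, Liu and Nakaoka: $\mathcal C$ is an additive category, $\mathbb E\colon\mathcal C^{\mathrm{op}}\times\mathcal C\to\mathrm{Ab}$ is an additive bifunctor, and $\mathfrak s$ is an exact realization of $\mathbb E$ satisfying (EA1), (EA2) and (EA2$^{\mathrm{op}}$), which assigns to every $\delta\in\mathbb E(C,A)$ a homotopy class $[X^\bullet]$ of complexes $A=X^0\xrightarrow{d^0}X^1\to\cdots\to X^n\xrightarrow{d^n}X^{n+1}=C$. Assume that $\mathcal C$ has weak kernels. For an additive subbifunctor $\mathbb F\subseteq\mathbb E$, call $\mathbb F$ *closed* if for every complex $X^\bullet$ with $\mathfrak s(\delta)=[X^\bullet]$ for some $\delta\in\mathbb F(X^{n+1},X^0)$ the sequences $$\mathbb F(-,X^0)\to\mathbb F(-,X^1)\to\mathbb F(-,X^2)\quad\text{and}\quad \mathbb F(X^{n+1},-)\to\mathbb F(X^n,-)\to\mathbb F(X^{n-1},-)$$ induced by the differentials of $X^\bullet$ are exact. If $\mathfrak s(\delta)=[X^\bullet]$,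 the *contravariant defect* of $\delta$ is the functor $\widetilde\delta=\operatorname{Coker}\big(\mathcal C(-,X^n)\xrightarrow{\mathcal C(-,d^n)}\mathcal C(-,X^{n+1})\big)\colon\mathcal C^{\mathrm{op}}\to\mathrm{Ab}$. Let $\operatorname{def}\mathbb F$ be the full subcategory of the category of finitely presented functors $\mathcal C^{\mathrm{op}}\to\mathrm{Ab}$ consisting of all functors isomorphic to $\widetilde\delta$ for some $A,C\in\mathcal C$ and $\delta\in\mathbb F(C,A)$; in particular this defines $\operatorname{def}\mathbb E\supseteq\operatorname{def}\mathbb F$. A *Serre subcategory* of $\operatorname{def}\mathbb E$ is a full subcategory containing the zero object and closed under subobjects, quotients and extensions in $\operatorname{def}\mathbb E$. Then $\mathbb F\mapsto\operatorname{def}\mathbb F$ is an isomorphism of posets (a bijection which preserves and reflects inclusions) from the poset of closed subbifunctors of $\mathbb E$ to the poset of Serre subcategories of $\operatorname{def}\mathbb E$, both ordered by inclusion. -/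

import Mathlib

open CategoryTheory CategoryTheory.Limits Opposite

universe v u

namespace NExact

section Complexes

variable {𝒞 : Type u} [Category.{v} 𝒞] [Preadditive 𝒞]

/-- A complex `X⁰ ⟶ X¹ ⟶ ⋯ ⟶ Xⁿ⁺¹` of length `n + 2` (all other terms are zero) with end terms
`A` and `C`. The end terms are identified with `A` and `C` through specified isomorphisms
`left : X⁰ ≅ A` and `right : Xⁿ⁺¹ ≅ C` (rather than equalities of objects). -/
structure Cpx (n : ℕ) (A C : 𝒞) where
  /-- the underlying complex -/
  cx : CochainComplex 𝒞 ℕ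
  isZero : ∀ i, n + 1 < i → IsZero (cx.X i)
  /-- identification of the term of degree `0` -/
  left : cx.X 0 ≅ A
  /-- identification of the term of degree `n + 1` -/
  right : cx.X (n + 1) ≅ C

variable {n : ℕ} {A B C D : 𝒞}

/-- The first differential `A ⟶ X¹`. -/
def Cpx.dFirst (X : Cpx n A C) : A ⟶ X.cx.X 1 := X.left.inv ≫ X.cx.d 0 1

/-- The last differential `Xⁿ ⟶ C`. -/
def Cpx.dLast (X : Cpx n A C) : X.cx.X n ⟶ C := X.cx.d n (n + 1) ≫ X.right.hom

/-- The morphism of complexes `f` is of the form `(a, f¹, …, fⁿ, c)`. -/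
def IsLift (X : Cpx n A C) (Y : Cpx n B D) (a : A ⟶ B) (c : C ⟶ D) (f : X.cx ⟶ Y.cx) : Prop :=
  f.f 0 ≫ Y.left.hom = X.left.hom ≫ a ∧ f.f (n + 1) ≫ Y.right.hom = X.right.hom ≫ c

/-- Homotopy equivalence of complexes with fixed end terms `A` and `C`: both morphisms
are the identity on the end terms, and both composites are homotopic to the identity. -/
def HtpyEquiv (X Y : Cpx n A C) : Prop :=
  ∃ (f : X.cx ⟶ Y.cx) (g : Y.cx ⟶ X.cx), IsLift X Y (𝟙 A) (𝟙 C) f ∧ IsLift Y X (𝟙 A) (𝟙 C) g ∧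
    Nonempty (Homotopy (f ≫ g) (𝟙 X.cx)) ∧ Nonempty (Homotopy (g ≫ f) (𝟙 Y.cx))

theorem IsLift.id (X : Cpx n A C) : IsLift X X (𝟙 A) (𝟙 C) (𝟙 X.cx) := by
  simp [IsLift]

theorem IsLift.comp {X Y Z : Cpx n A C} {f : X.cx ⟶ Y.cx} {g : Y.cx ⟶ Z.cx}
    (hf : IsLift X Y (𝟙 A) (𝟙 C) f) (hg : IsLift Y Z (𝟙 A) (𝟙 C) g) :
    IsLift X Z (𝟙 A) (𝟙 C) (f ≫ g) := by
  obtain ⟨h1, h2⟩ := hf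
  obtain ⟨h3, h4⟩ := hg
  simp only [Category.comp_id] at h1 h2 h3 h4
  simp [IsLift, h1, h2, h3, h4]

theorem homotopy_comp_comp {K L M : CochainComplex 𝒞 ℕ} {f : K ⟶ L} {g : L ⟶ K} {f' : L ⟶ M}
    {g' : M ⟶ L} (h : Nonempty (Homotopy (f ≫ g) (𝟙 K)))
    (h' : Nonempty (Homotopy (f' ≫ g') (𝟙 L))) :
    Nonempty (Homotopy ((f ≫ f') ≫ (g' ≫ g)) (𝟙 K)) := by
  obtain ⟨h⟩ := h
  obtain ⟨h'⟩ := h'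
  have k := (h'.compLeft f).compRight g
  exact ⟨((Homotopy.ofEq (by simp)).trans k).trans ((Homotopy.ofEq (by simp)).trans h)⟩

/-- Homotopy equivalence with fixed end terms is an equivalence relation. -/
instance cpxSetoid (n : ℕ) (A C : 𝒞) : Setoid (Cpx n A C) where
  r := HtpyEquiv
  iseqv :=
    { refl := fun X => ⟨𝟙 _, 𝟙 _, IsLift.id X, IsLift.id X, ⟨Homotopy.ofEq (by simp)⟩,
        ⟨Homotopy.ofEq (by simp)⟩⟩
      symm := fun ⟨f, g, hf, hg, h, k⟩ => ⟨g, f, hg, hf, k, h⟩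
      trans := fun ⟨f, g, hf, hg, h, k⟩ ⟨f', g', hf', hg', h', k'⟩ =>
        ⟨f ≫ f', g' ≫ g, hf.comp hf', hg'.comp hg, homotopy_comp_comp h h',
          homotopy_comp_comp k' k⟩ }

/-- For `f = (1_A, f¹, …, fⁿ, c) : X ⟶ Y`, the complex `M` is the mapping cone
`X¹ ⟶ X² ⊕ Y¹ ⟶ ⋯ ⟶ Xⁿ⁺¹ ⊕ Yⁿ ⟶ Yⁿ⁺¹` with differentials
`(-d_X¹, f¹)`, `((-d_Xⁱ⁺¹, 0), (fⁱ⁺¹, d_Yⁱ))`, `(fⁿ⁺¹, d_Yⁿ)`.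
The maps `p i : Mⁱ ⟶ Xⁱ⁺¹` (`0 ≤ i ≤ n`) and `q i : Mⁱ⁺¹ ⟶ Yⁱ⁺¹` (`0 ≤ i ≤ n`) are the
projections; they exhibit `Mⁱ⁺¹` as the direct sum of `Xⁱ⁺²` and `Yⁱ⁺¹` for `0 ≤ i < n`. -/
def IsMappingCone (X : Cpx n A C) (Y : Cpx n A D) (f : X.cx ⟶ Y.cx)
    (M : Cpx n (X.cx.X 1) D) : Prop :=
  ∃ (p : ∀ i, M.cx.X i ⟶ X.cx.X (i + 1)) (q : ∀ i, M.cx.X (i + 1) ⟶ Y.cx.X (i + 1)),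
    p 0 = M.left.hom ∧ q n ≫ Y.right.hom = M.right.hom ∧
    (∀ i < n, Nonempty (IsLimit (BinaryFan.mk (p (i + 1)) (q i)))) ∧
    (∀ i < n, M.cx.d i (i + 1) ≫ p (i + 1) = -(p i ≫ X.cx.d (i + 1) (i + 2))) ∧
    M.cx.d 0 1 ≫ q 0 = p 0 ≫ f.f 1 ∧
    (∀ i < n, M.cx.d (i + 1) (i + 2) ≫ q (i + 1) =
      p (i + 1) ≫ f.f (i + 2) + q i ≫ Y.cx.d (i + 1) (i + 2))

/-- For `f = (a, f¹, …, fⁿ, 1_C) : X ⟶ Y`, the complex `N` is the mapping cocone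
`X⁰ ⟶ X¹ ⊕ Y⁰ ⟶ ⋯ ⟶ Xⁿ ⊕ Yⁿ⁻¹ ⟶ Yⁿ` with differentials
`(d_X⁰, f⁰)`, `((d_Xⁱ, 0), (fⁱ, -d_Yⁱ⁻¹))`, `(fⁿ, -d_Yⁿ⁻¹)`
(this is the mapping cone formed in the opposite category).
The maps `p i : Nⁱ ⟶ Xⁱ` (`0 ≤ i ≤ n`) and `q i : Nⁱ⁺¹ ⟶ Yⁱ` (`0 ≤ i ≤ n`) are the
projections; they exhibit `Nⁱ⁺¹` as the direct sum of `Xⁱ⁺¹` and `Yⁱ` for `0 ≤ i < n`. -/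
def IsMappingCocone (X : Cpx n A C) (Y : Cpx n B C) (f : X.cx ⟶ Y.cx)
    (N : Cpx n A (Y.cx.X n)) : Prop :=
  ∃ (p : ∀ i, N.cx.X i ⟶ X.cx.X i) (q : ∀ i, N.cx.X (i + 1) ⟶ Y.cx.X i),
    p 0 ≫ X.left.hom = N.left.hom ∧ q n = N.right.hom ∧
    (∀ i < n, Nonempty (IsLimit (BinaryFan.mk (p (i + 1)) (q i)))) ∧
    (∀ i < n, N.cx.d i (i + 1) ≫ p (i + 1) = p i ≫ X.cx.d i (i + 1)) ∧
    N.cx.d 0 1 ≫ q 0 = p 0 ≫ f.f 0 ∧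
    (∀ i < n, N.cx.d (i + 1) (i + 2) ≫ q (i + 1) =
      p (i + 1) ≫ f.f (i + 1) - q i ≫ Y.cx.d i (i + 1))

end Complexes

section Extensions

variable {𝒞 : Type u} [Category.{v} 𝒞]

/-- The group `𝔼(C, A)` of extensions. -/
abbrev Ext (E : 𝒞ᵒᵖ ⥤ 𝒞 ⥤ AddCommGrpCat.{v}) (C A : 𝒞) : Type v := (E.obj (op C)).obj A

variable {E : 𝒞ᵒᵖ ⥤ 𝒞 ⥤ AddCommGrpCat.{v}}

/-- `push a δ = a_* δ = 𝔼(C, a)(δ)`. -/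
def push {A B C : 𝒞} (a : A ⟶ B) : Ext E C A →+ Ext E C B := ((E.obj (op C)).map a).hom

/-- `pull c δ = c^* δ = 𝔼(c, A)(δ)`. -/
def pull {A C D : 𝒞} (c : D ⟶ C) : Ext E C A →+ Ext E D A := ((E.map c.op).app A).hom

variable [Preadditive 𝒞] {n : ℕ} {A C : 𝒞}

/-- The pair `⟨X, δ⟩` is an `n`-exangle: `(d⁰)_* δ = 0`, `(dⁿ)^* δ = 0`, and the sequences
`𝒞(-, X⁰) ⟶ ⋯ ⟶ 𝒞(-, Xⁿ⁺¹) ⟶ 𝔼(-, X⁰)` and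
`𝒞(Xⁿ⁺¹, -) ⟶ ⋯ ⟶ 𝒞(X⁰, -) ⟶ 𝔼(Xⁿ⁺¹, -)` are exact. -/
structure IsExangle (X : Cpx n A C) (δ : Ext E C A) : Prop where
  push_dFirst : push X.dFirst δ = 0
  pull_dLast : pull X.dLast δ = 0
  exact_mid : ∀ i < n, ∀ (T : 𝒞) (f : T ⟶ X.cx.X (i + 1)), f ≫ X.cx.d (i + 1) (i + 2) = 0 →
    ∃ g : T ⟶ X.cx.X i, g ≫ X.cx.d i (i + 1) = f
  exact_right : ∀ (T : 𝒞) (f : T ⟶ C), pull f δ = 0 → ∃ g : T ⟶ X.cx.X n, g ≫ X.dLast = f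
  coexact_mid : ∀ i < n, ∀ (T : 𝒞) (f : X.cx.X (i + 1) ⟶ T), X.cx.d i (i + 1) ≫ f = 0 →
    ∃ g : X.cx.X (i + 2) ⟶ T, X.cx.d (i + 1) (i + 2) ≫ g = f
  coexact_left : ∀ (T : 𝒞) (f : A ⟶ T), push f δ = 0 → ∃ g : X.cx.X 1 ⟶ T, X.dFirst ≫ g = f

/-- An additive subbifunctor of `𝔼`. -/
@[ext]
structure Subbifunctor (E : 𝒞ᵒᵖ ⥤ 𝒞 ⥤ AddCommGrpCat.{v}) where
  /-- the subgroup of `𝔼(C, A)` -/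
  grp : ∀ C A : 𝒞, AddSubgroup (Ext E C A)
  push_mem : ∀ {A B C : 𝒞} (a : A ⟶ B) {δ : Ext E C A}, δ ∈ grp C A → push a δ ∈ grp C B
  pull_mem : ∀ {A C D : 𝒞} (c : D ⟶ C) {δ : Ext E C A}, δ ∈ grp C A → pull c δ ∈ grp D A

/-- Additive subbifunctors are ordered by inclusion. -/
instance : PartialOrder (Subbifunctor E) :=
  PartialOrder.lift Subbifunctor.grp fun _ _ h => Subbifunctor.ext h

/-- `𝔼` as a subbifunctor of itself. -/
instance : Top (Subbifunctor E) where
  top := { grp := fun _ _ => ⊤, push_mem := fun _ _ _ => trivial, pull_mem := fun _ _ _ => trivial }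

end Extensions

section Exangulated

variable {𝒞 : Type u} [Category.{v} 𝒞] [Preadditive 𝒞]

/-- A realization: it assigns to each `δ ∈ 𝔼(C, A)` a homotopy equivalence class `𝔰(δ)`
of complexes with end terms `A` and `C`. -/
abbrev Realization (n : ℕ) (E : 𝒞ᵒᵖ ⥤ 𝒞 ⥤ AddCommGrpCat.{v}) : Type (max u v) :=
  ∀ {A C : 𝒞}, Ext E C A → Quotient (cpxSetoid n A C)

variable {n : ℕ} {E : 𝒞ᵒᵖ ⥤ 𝒞 ⥤ AddCommGrpCat.{v}}

/-- `f` is an inflation: up to an isomorphism of its target, it is the first differential of a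
complex realizing some extension. -/
def IsInflation (s : Realization n E) {A B : 𝒞} (f : A ⟶ B) : Prop :=
  ∃ (C : 𝒞) (δ : Ext E C A) (X : Cpx n A C) (e : X.cx.X 1 ≅ B),
    s δ = ⟦X⟧ ∧ X.dFirst ≫ e.hom = f

/-- `g` is a deflation: up to an isomorphism of its source, it is the last differential of a
complex realizing some extension. -/
def IsDeflation (s : Realization n E) {B C : 𝒞} (g : B ⟶ C) : Prop :=
  ∃ (A : 𝒞) (δ : Ext E C A) (X : Cpx n A C) (e : B ≅ X.cx.X n),
    s δ = ⟦X⟧ ∧ e.hom ≫ X.dLast = g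

/-- The structure `(𝔼, 𝔰)` of an `n`-exangulated category on an additive category `𝒞`. -/
structure Exangulated (n : ℕ) (𝒞 : Type u) [Category.{v} 𝒞] [Preadditive 𝒞]
    [HasFiniteBiproducts 𝒞] where
  /-- the bifunctor of extensions -/
  E : 𝒞ᵒᵖ ⥤ 𝒞 ⥤ AddCommGrpCat.{v}
  /-- the realization -/
  s : Realization n E
  additive_contra : E.Additive
  additive_co : ∀ C : 𝒞ᵒᵖ, (E.obj C).Additive
  /-- (R0): every morphism of extensions lifts to the realizing complexes. -/
  exists_lift : ∀ {A B C D : 𝒞} (δ : Ext E C A) (ρ : Ext E D B) (X : Cpx n A C) (Y : Cpx n B D),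
    s δ = ⟦X⟧ → s ρ = ⟦Y⟧ → ∀ (a : A ⟶ B) (c : C ⟶ D), push a δ = pull c ρ →
      ∃ f : X.cx ⟶ Y.cx, IsLift X Y a c f
  /-- (R1) -/
  isExangle : ∀ {A C : 𝒞} (δ : Ext E C A) (X : Cpx n A C), s δ = ⟦X⟧ → IsExangle X δ
  /-- (R2): `𝔰(0) = [A = A ⟶ 0 ⟶ ⋯ ⟶ 0]` for `0 ∈ 𝔼(0, A)`. -/
  real_zero_left : ∀ {A Z : 𝒞}, IsZero Z → ∀ X : Cpx n A Z, IsIso (X.cx.d 0 1) →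
    (∀ i, 2 ≤ i → IsZero (X.cx.X i)) → s (0 : Ext E Z A) = ⟦X⟧
  /-- (R2): `𝔰(0) = [0 ⟶ ⋯ ⟶ 0 ⟶ A = A]` for `0 ∈ 𝔼(A, 0)`. -/
  real_zero_right : ∀ {A Z : 𝒞}, IsZero Z → ∀ X : Cpx n Z A, IsIso (X.cx.d n (n + 1)) →
    (∀ i, i < n → IsZero (X.cx.X i)) → s (0 : Ext E A Z) = ⟦X⟧
  /-- (EA1) for inflations -/
  inflation_comp : ∀ {A B C : 𝒞} (f : A ⟶ B) (g : B ⟶ C),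
    IsInflation s f → IsInflation s g → IsInflation s (f ≫ g)
  /-- (EA1) for deflations -/
  deflation_comp : ∀ {A B C : 𝒞} (f : A ⟶ B) (g : B ⟶ C),
    IsDeflation s f → IsDeflation s g → IsDeflation s (f ≫ g)
  /-- (EA2): `(1_A, c)` has a lift whose mapping cone realizes `(d_X⁰)_* ρ`. -/
  good_lift : ∀ {A C D : 𝒞} (ρ : Ext E D A) (c : C ⟶ D) (X : Cpx n A C) (Y : Cpx n A D),
    s (pull c ρ) = ⟦X⟧ → s ρ = ⟦Y⟧ →
      ∃ f : X.cx ⟶ Y.cx, IsLift X Y (𝟙 A) c f ∧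
        ∃ M : Cpx n (X.cx.X 1) D, IsMappingCone X Y f M ∧ s (push X.dFirst ρ) = ⟦M⟧
  /-- the dual of (EA2): `(a, 1_C)` has a lift whose mapping cocone realizes `(d_Yⁿ)^* ρ`. -/
  good_lift_op : ∀ {A B C : 𝒞} (ρ : Ext E C A) (a : A ⟶ B) (X : Cpx n A C) (Y : Cpx n B C),
    s ρ = ⟦X⟧ → s (push a ρ) = ⟦Y⟧ →
      ∃ f : X.cx ⟶ Y.cx, IsLift X Y a (𝟙 C) f ∧
        ∃ N : Cpx n A (Y.cx.X n), IsMappingCocone X Y f N ∧ s (pull Y.dLast ρ) = ⟦N⟧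

variable [HasFiniteBiproducts 𝒞] (S : Exangulated n 𝒞)

/-- `F` is closed on the right: `F(-, X⁰) ⟶ F(-, X¹) ⟶ F(-, X²)` is exact for every complex `X`
realizing an extension in `F`. -/
def IsClosedRight (F : Subbifunctor S.E) : Prop :=
  ∀ {A C : 𝒞} (δ : Ext S.E C A) (X : Cpx n A C), δ ∈ F.grp C A → S.s δ = ⟦X⟧ →
    ∀ (T : 𝒞), ∀ θ ∈ F.grp T (X.cx.X 1),
      push (X.cx.d 1 2) θ = 0 ↔ ∃ θ' ∈ F.grp T A, push X.dFirst θ' = θ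

/-- `F` is closed on the left: `F(Xⁿ⁺¹, -) ⟶ F(Xⁿ, -) ⟶ F(Xⁿ⁻¹, -)` is exact for every complex
`X` realizing an extension in `F`. -/
def IsClosedLeft (F : Subbifunctor S.E) : Prop :=
  ∀ {A C : 𝒞} (δ : Ext S.E C A) (X : Cpx n A C), δ ∈ F.grp C A → S.s δ = ⟦X⟧ →
    ∀ (T : 𝒞), ∀ θ ∈ F.grp (X.cx.X n) T,
      pull (X.cx.d (n - 1) n) θ = 0 ↔ ∃ θ' ∈ F.grp C T, pull X.dLast θ' = θ

/-- The poset of closed subbifunctors of `𝔼`, ordered by inclusion. -/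
abbrev ClosedSubbifunctor : Type (max u v) :=
  {F : Subbifunctor S.E // IsClosedRight S F ∧ IsClosedLeft S F}

/-- Finitely presented right `𝒞`-modules: functors `G` with an exact sequence
`𝒞(-, X) ⟶ 𝒞(-, Y) ⟶ G ⟶ 0`. -/
def finitelyPresented (𝒞 : Type u) [Category.{v} 𝒞] [Preadditive 𝒞] :
    ObjectProperty (𝒞ᵒᵖ ⥤ AddCommGrpCat.{v}) :=
  fun G => ∃ (X Y : 𝒞) (f : X ⟶ Y), Nonempty (G ≅ cokernel (preadditiveYoneda.map f))

/-- The contravariant defect of an extension realized by `X`: the cokernel of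
`𝒞(-, Xⁿ) ⟶ 𝒞(-, Xⁿ⁺¹)`. -/
noncomputable def defect {A C : 𝒞} (X : Cpx n A C) : 𝒞ᵒᵖ ⥤ AddCommGrpCat.{v} :=
  cokernel (preadditiveYoneda.map X.dLast)

/-- `def F`: the finitely presented functors isomorphic to the contravariant defect of some
extension in `F`. -/
def defectsOf (F : Subbifunctor S.E) : ObjectProperty (𝒞ᵒᵖ ⥤ AddCommGrpCat.{v}) :=
  fun G => finitelyPresented 𝒞 G ∧ ∃ (A C : 𝒞) (δ : Ext S.E C A) (X : Cpx n A C),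
    δ ∈ F.grp C A ∧ S.s δ = ⟦X⟧ ∧ Nonempty (G ≅ defect X)

theorem defectsOf_mono {F F' : Subbifunctor S.E} (h : F ≤ F') : defectsOf S F ≤ defectsOf S F' :=
  fun _ ⟨hG, A, C, δ, X, hδ, hX, e⟩ => ⟨hG, A, C, δ, X, h C A hδ, hX, e⟩

theorem defectsOf_le_top (F : Subbifunctor S.E) : defectsOf S F ≤ defectsOf S ⊤ :=
  defectsOf_mono S fun _ _ _ _ => trivial

/-- The category `def 𝔼`. -/
abbrev DefE : Type (max u (v + 1)) := (defectsOf S ⊤).FullSubcategory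

/-- `def F` as a full subcategory of `def 𝔼` (it is contained in `def 𝔼` by `defectsOf_le_top`). -/
def defectsIn (F : Subbifunctor S.E) : ObjectProperty (DefE S) :=
  (defectsOf S F).inverseImage (defectsOf S ⊤).ι

end Exangulated

/-- A Serre subcategory, as a full subcategory: it contains the zero object and is closed under
subobjects, quotients and extensions. (The notion is used in the abelian category `def 𝔼`.) -/
structure IsSerre {𝒜 : Type*} [Category* 𝒜] [Preadditive 𝒜] (P : ObjectProperty 𝒜) : Prop where
  containsZero : P.ContainsZero
  subobjects : P.IsClosedUnderSubobjects
  quotients : P.IsClosedUnderQuotients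
  extensions : P.IsClosedUnderExtensions

/-- The poset of Serre subcategories, ordered by inclusion. -/
abbrev SerreSubcategory (𝒜 : Type*) [Category* 𝒜] [Preadditive 𝒜] :=
  {P : ObjectProperty 𝒜 // IsSerre P}

end NExact

/-!
For an extension `δ ∈ 𝔼(C, A)` realized by `X`, exactness of
`𝒞(-, Xⁿ) ⟶ 𝒞(-, C) ⟶ 𝔼(-, A)` identifies the contravariant defect of `δ` with the subfunctor of
`𝔼(-, A)` generated by `δ`. Throughout, a functor `G` in `def 𝔼` is therefore handled through a
surjection `π : 𝒞(-, C) ⟶ G` whose kernel is the annihilator of some `δ` (`Presents π δ`), and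
all questions about `def 𝔼` become questions about annihilators of extensions. The subfunctor
generated by an element of `G` is the defect of a pullback `c^* δ`, and the quotient by it is the
defect of a pushout of `δ`; hence monomorphisms and epimorphisms of `def 𝔼` are pointwise injective
and surjective (`eq_zero_of_mono`, `surjective_of_epi`), and short exact sequences of `def 𝔼` are
pointwise exact.

The homological input consists of the exact sequences
`𝒞(-, C) ⟶ 𝔼(-, A) ⟶ 𝔼(-, X¹) ⟶ 𝔼(-, X²)` and their duals (`exists_pull_eq`,
`exists_push_dFirst_eq`, `exists_push_eq`, `exists_pull_dLast_eq`), obtained from mapping cones of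
good lifts.

* If every morphism annihilating `ρ ∈ F(C, B)` annihilates `δ ∈ 𝔼(C, A)`, then `δ` is a pushout of
  `ρ` and so lies in `F` (`mem_of_pull_eq_zero`). Consequently the defect of `δ` belongs to `def F`
  if and only if `δ ∈ F`, and `F ↦ def F` preserves and reflects inclusions.
* Let `Z` realize `t^* δ`, with first differential `d⁰`. The defect of `δ` is an extension of the
  defect of `(d⁰)_* δ` by the defect of `t^* δ`. If `F` is closed and contains `t^* δ` and
  `(d⁰)_* δ`, then it contains `δ` (`mem_of_pull_mem_of_push_mem`), so `def F` is closed under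
  extensions.
* Conversely, the extensions with defect in a Serre subcategory `P` form a subbifunctor
  (`subbifunctorOfSerre`) by the same description of extensions of defects
  (`HasDefectIn.of_pull_of_push`), which also yields its closedness. By construction its defects
  are the objects of `P`.
-/

namespace NExact

/-! ### The action of morphisms on extensions -/

section Action

variable {𝒞 : Type u} [Category.{v} 𝒞] {E : 𝒞ᵒᵖ ⥤ 𝒞 ⥤ AddCommGrpCat.{v}} {A B B' C D D' : 𝒞}

theorem push_id (δ : Ext E C A) : push (𝟙 A) δ = δ := by
  simp [push]

theorem pull_id (δ : Ext E C A) : pull (𝟙 C) δ = δ := by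
  simp [pull]

theorem push_comp (a : A ⟶ B) (b : B ⟶ B') (δ : Ext E C A) :
    push (a ≫ b) δ = push b (push a δ) := by
  simp [push]

theorem pull_comp (c : D' ⟶ D) (d : D ⟶ C) (δ : Ext E C A) :
    pull (c ≫ d) δ = pull c (pull d δ) := by
  simp [pull]

theorem push_pull (a : A ⟶ B) (c : D ⟶ C) (δ : Ext E C A) :
    push a (pull c δ) = pull c (push a δ) := by
  have := ConcreteCategory.congr_hom ((E.map c.op).naturality a) δ
  exact this.symm

variable [Preadditive 𝒞]

theorem pull_add [E.Additive] (c c' : D ⟶ C) (δ : Ext E C A) :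
    pull (c + c') δ = pull c δ + pull c' δ := by
  simp [pull, Functor.map_add]

theorem pull_zero [E.Additive] (δ : Ext E C A) : pull (0 : D ⟶ C) δ = 0 := by
  simp [pull]

theorem pull_neg [E.Additive] (c : D ⟶ C) (δ : Ext E C A) : pull (-c) δ = -pull c δ := by
  rw [eq_neg_iff_add_eq_zero, ← pull_add, neg_add_cancel, pull_zero]

theorem pull_sub [E.Additive] (c c' : D ⟶ C) (δ : Ext E C A) :
    pull (c - c') δ = pull c δ - pull c' δ := by
  rw [sub_eq_add_neg, pull_add, pull_neg, sub_eq_add_neg]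

theorem push_add [∀ C : 𝒞ᵒᵖ, (E.obj C).Additive] (a a' : A ⟶ B) (δ : Ext E C A) :
    push (a + a') δ = push a δ + push a' δ := by
  simp [push, Functor.map_add]

theorem push_zero [∀ C : 𝒞ᵒᵖ, (E.obj C).Additive] (δ : Ext E C A) :
    push (0 : A ⟶ B) δ = 0 := by
  simp [push]

end Action

/-! ### Differentials of complexes, mapping cones and cocones -/

section Cones

variable {𝒞 : Type u} [Category.{v} 𝒞] [Preadditive 𝒞] {n : ℕ} {A B C D : 𝒞}

theorem Cpx.dFirst_d (X : Cpx n A C) : X.dFirst ≫ X.cx.d 1 2 = 0 := by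
  simp [Cpx.dFirst]

theorem Cpx.d_dLast (X : Cpx n A C) : X.cx.d (n - 1) n ≫ X.dLast = 0 := by
  simp [Cpx.dLast]

theorem exists_sections_of_isLimit {P X Y : 𝒞} {p : P ⟶ X} {q : P ⟶ Y}
    (h : IsLimit (BinaryFan.mk p q)) : ∃ (i : X ⟶ P) (j : Y ⟶ P), p ≫ i + q ≫ j = 𝟙 P := by
  obtain ⟨i, hi₁, hi₂⟩ := BinaryFan.IsLimit.lift' h (𝟙 X) (0 : X ⟶ Y)
  obtain ⟨j, hj₁, hj₂⟩ := BinaryFan.IsLimit.lift' h (0 : Y ⟶ X) (𝟙 Y)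
  dsimp at hi₁ hi₂ hj₁ hj₂
  refine ⟨i, j, BinaryFan.IsLimit.hom_ext h ?_ ?_⟩
  · dsimp
    simp [hi₁, hj₁]
  · dsimp
    simp [hi₂, hj₂]

variable {X : Cpx n A C}

theorem IsMappingCone.dLast_eq (hn : 0 < n) {Y : Cpx n A D} {c : C ⟶ D} {f : X.cx ⟶ Y.cx}
    (hf : IsLift X Y (𝟙 A) c f) {M : Cpx n (X.cx.X 1) D} (hM : IsMappingCone X Y f M) :
    ∃ (u : M.cx.X n ⟶ C) (w : M.cx.X n ⟶ Y.cx.X n), M.dLast = u ≫ c + w ≫ Y.dLast := by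
  obtain ⟨m, rfl⟩ : ∃ m, n = m + 1 := ⟨n - 1, by omega⟩
  obtain ⟨p, q, -, hq, -, -, -, h⟩ := hM
  refine ⟨p (m + 1) ≫ X.right.hom, q m, ?_⟩
  rw [Cpx.dLast, ← hq, reassoc_of% (h m (by omega)), Preadditive.add_comp, Cpx.dLast,
    Category.assoc, Category.assoc, Category.assoc, hf.2]

theorem IsMappingCone.dFirst_eq (hn : 0 < n) {Y : Cpx n A D} {f : X.cx ⟶ Y.cx}
    {M : Cpx n (X.cx.X 1) D} (hM : IsMappingCone X Y f M) :
    ∃ (i : X.cx.X 2 ⟶ M.cx.X 1) (j : Y.cx.X 1 ⟶ M.cx.X 1),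
      M.dFirst = X.cx.d 1 2 ≫ i + f.f 1 ≫ j := by
  obtain ⟨p, q, hp, -, hl, hd, h, -⟩ := hM
  obtain ⟨i, j, hij⟩ := exists_sections_of_isLimit (hl 0 hn).some
  have h1 : M.dFirst ≫ p 1 = -X.cx.d 1 2 := by
    simp [Cpx.dFirst, hd 0 hn, hp]
  have h2 : M.dFirst ≫ q 0 = f.f 1 := by
    simp [Cpx.dFirst, h, hp]
  refine ⟨-i, j, ?_⟩
  rw [← Category.comp_id M.dFirst, ← hij]
  simp [reassoc_of% h1, reassoc_of% h2]

theorem IsMappingCocone.dFirst_eq (hn : 0 < n) {Y : Cpx n B C} {a : A ⟶ B} {f : X.cx ⟶ Y.cx}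
    (hf : IsLift X Y a (𝟙 C) f) {N : Cpx n A (Y.cx.X n)} (hN : IsMappingCocone X Y f N) :
    ∃ (i : X.cx.X 1 ⟶ N.cx.X 1) (j : B ⟶ N.cx.X 1), N.dFirst = X.dFirst ≫ i + a ≫ j := by
  obtain ⟨p, q, hp, -, hl, hd, h, -⟩ := hN
  obtain ⟨i, j, hij⟩ := exists_sections_of_isLimit (hl 0 hn).some
  have hp' : p 0 = N.left.hom ≫ X.left.inv := by simp [← hp]
  have h1 : N.dFirst ≫ p 1 = X.dFirst := by
    simp [Cpx.dFirst, hd 0 hn, hp']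
  have h2 : N.dFirst ≫ q 0 = a ≫ Y.left.inv := by
    have := hf.1
    rw [← Iso.inv_comp_eq, ← Category.assoc, ← Iso.eq_comp_inv] at this
    simp [Cpx.dFirst, h, hp', this]
  refine ⟨i, Y.left.inv ≫ j, ?_⟩
  rw [← Category.comp_id N.dFirst, ← hij]
  simp [reassoc_of% h1, reassoc_of% h2]

theorem IsMappingCocone.dLast_eq (hn : 0 < n) {Y : Cpx n B C} {f : X.cx ⟶ Y.cx}
    {N : Cpx n A (Y.cx.X n)} (hN : IsMappingCocone X Y f N) :
    ∃ (u : N.cx.X n ⟶ X.cx.X n) (w : N.cx.X n ⟶ Y.cx.X (n - 1)),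
      N.dLast = u ≫ f.f n + w ≫ Y.cx.d (n - 1) n := by
  obtain ⟨m, rfl⟩ : ∃ m, n = m + 1 := ⟨n - 1, by omega⟩
  obtain ⟨p, q, -, hq, -, -, -, h⟩ := hN
  refine ⟨p (m + 1), -q m, ?_⟩
  rw [Cpx.dLast, ← hq, h m (by omega)]
  simp [sub_eq_add_neg]

end Cones

/-! ### The long exact sequences of extension groups -/

section LongExact

variable {𝒞 : Type u} [Category.{v} 𝒞] [Preadditive 𝒞] [HasFiniteBiproducts 𝒞] {n : ℕ}
  (S : Exangulated n 𝒞) {A C T : 𝒞}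

instance : S.E.Additive := S.additive_contra

instance (C : 𝒞ᵒᵖ) : (S.E.obj C).Additive := S.additive_co C

variable {S}

theorem Exangulated.exists_realization (δ : Ext S.E C A) : ∃ X : Cpx n A C, S.s δ = ⟦X⟧ :=
  (Quotient.exists_rep (S.s δ)).imp fun _ h => h.symm

variable {δ : Ext S.E C A} {X : Cpx n A C}

/-- Exactness of `𝒞(-, C) ⟶ 𝔼(-, A) ⟶ 𝔼(-, X¹)`. If `θ` dies in `𝔼(T, X¹)`, then so does the
extension `ρ` of `C ⊞ T` by `A` with components `δ` and `θ`; the cone of a good lift of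
`C ⟶ C ⊞ T` therefore has a split last differential, which expresses `ρ` through `δ`. -/
theorem exists_pull_eq (hn : 0 < n) (hX : S.s δ = ⟦X⟧) (θ : Ext S.E T A)
    (hθ : push X.dFirst θ = 0) : ∃ t : T ⟶ C, pull t δ = θ := by
  have := hasBinaryBiproducts_of_finite_biproducts 𝒞
  let ρ : Ext S.E (C ⊞ T) A := pull biprod.fst δ + pull biprod.snd θ
  have hl : pull biprod.inl ρ = δ := by
    simp [ρ, ← pull_comp, pull_id, pull_zero]
  have hr : pull biprod.inr ρ = θ := by
    simp [ρ, ← pull_comp, pull_id, pull_zero]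
  have h0 : push X.dFirst ρ = 0 := by
    simp [ρ, push_pull, hθ, (S.isExangle δ X hX).push_dFirst]
  obtain ⟨Y, hY⟩ := S.exists_realization ρ
  obtain ⟨f, hf, M, hM, hsM⟩ := S.good_lift ρ biprod.inl X Y (by rw [hl, hX]) hY
  obtain ⟨u, w, huw⟩ := hM.dLast_eq hn hf
  obtain ⟨g, hg⟩ := (S.isExangle _ M hsM).exact_right _ (𝟙 _) (by rw [h0, map_zero])
  refine ⟨biprod.inr ≫ g ≫ u, ?_⟩
  rw [← hr]
  conv_rhs => rw [← pull_id ρ, ← hg, huw]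
  rw [Preadditive.comp_add, pull_add, ← Category.assoc g w, pull_comp (g ≫ w),
    (S.isExangle ρ Y hY).pull_dLast, map_zero, add_zero, ← Category.assoc g u, pull_comp (g ≫ u),
    hl, pull_comp]

/-- Exactness of `𝒞(A, -) ⟶ 𝔼(C, -) ⟶ 𝔼(Xⁿ, -)`, dual to `exists_pull_eq`. -/
theorem exists_push_eq (hn : 0 < n) (hX : S.s δ = ⟦X⟧) (θ : Ext S.E C T)
    (hθ : pull X.dLast θ = 0) : ∃ t : A ⟶ T, push t δ = θ := by
  have := hasBinaryBiproducts_of_finite_biproducts 𝒞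
  let ρ : Ext S.E C (A ⊞ T) := push biprod.inl δ + push biprod.inr θ
  have hl : push biprod.fst ρ = δ := by
    simp [ρ, ← push_comp, push_id, push_zero]
  have hr : push biprod.snd ρ = θ := by
    simp [ρ, ← push_comp, push_id, push_zero]
  have h0 : pull X.dLast ρ = 0 := by
    simp [ρ, ← push_pull, hθ, (S.isExangle δ X hX).pull_dLast]
  obtain ⟨Y, hY⟩ := S.exists_realization ρ
  obtain ⟨f, hf, N, hN, hsN⟩ := S.good_lift_op ρ biprod.fst Y X hY (by rw [hl, hX])
  obtain ⟨i, j, hij⟩ := hN.dFirst_eq hn hf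
  obtain ⟨g, hg⟩ := (S.isExangle _ N hsN).coexact_left _ (𝟙 _) (by rw [h0, map_zero])
  refine ⟨j ≫ g ≫ biprod.snd, ?_⟩
  rw [← hr]
  conv_rhs => rw [← push_id ρ, ← hg, hij]
  rw [Preadditive.add_comp, push_add, Category.assoc, push_comp Y.dFirst,
    (S.isExangle ρ Y hY).push_dFirst, map_zero, zero_add, Category.assoc, push_comp biprod.fst,
    hl, ← push_comp, Category.assoc]

/-- Exactness of `𝔼(-, A) ⟶ 𝔼(-, X¹) ⟶ 𝔼(-, X²)`. For `θ` realized by `Z`, the composite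
`A ⟶ X¹ ⟶ Z¹` is an inflation; let `ω` be an extension it belongs to. The cone of a good lift
over `ω` realizes `(d⁰)_* ω`, and its first differential annihilates `θ`. -/
theorem exists_push_dFirst_eq (hn : 0 < n) (hX : S.s δ = ⟦X⟧) (θ : Ext S.E T (X.cx.X 1))
    (hθ : push (X.cx.d 1 2) θ = 0) : ∃ θ' : Ext S.E T A, push X.dFirst θ' = θ := by
  obtain ⟨Z, hZ⟩ := S.exists_realization θ
  obtain ⟨D, ω, W, e, hW, he⟩ := S.inflation_comp X.dFirst Z.dFirst
    ⟨C, δ, X, Iso.refl _, hX, by simp⟩ ⟨T, θ, Z, Iso.refl _, hZ, by simp⟩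
  have he' : W.dFirst = X.dFirst ≫ Z.dFirst ≫ e.inv := by
    rw [← Category.assoc, ← he]; simp
  obtain ⟨c, hc⟩ := exists_pull_eq hn hW δ
    (by rw [he', push_comp, (S.isExangle δ X hX).push_dFirst, map_zero])
  obtain ⟨f, hf, M, hM, hsM⟩ := S.good_lift ω c X W (by rw [hc, hX]) hW
  have hf1 : X.dFirst ≫ f.f 1 = W.dFirst := by
    have := hf.1
    rw [Category.comp_id, ← Iso.eq_comp_inv] at this
    simp [Cpx.dFirst, ← f.comm, this]
  obtain ⟨k, hk⟩ := (S.isExangle δ X hX).coexact_mid 0 hn _ (f.f 1 - Z.dFirst ≫ e.inv) (by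
    rw [← cancel_epi X.left.inv, ← Category.assoc]
    change X.dFirst ≫ _ = _
    rw [Preadditive.comp_sub, hf1, he', sub_self, comp_zero])
  have hfθ : push (f.f 1) θ = 0 := by
    rw [← sub_add_cancel (f.f 1) (Z.dFirst ≫ e.inv), ← hk, push_add, push_comp, push_comp, hθ,
      (S.isExangle θ Z hZ).push_dFirst, map_zero, map_zero, add_zero]
  obtain ⟨i, j, hij⟩ := hM.dFirst_eq hn
  obtain ⟨t, ht⟩ := exists_pull_eq hn hsM θ
    (by rw [hij, push_add, push_comp, push_comp, hθ, hfθ, map_zero, map_zero, add_zero])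
  exact ⟨pull t ω, by rw [push_pull, ht]⟩

/-- Exactness of `𝔼(C, -) ⟶ 𝔼(Xⁿ, -) ⟶ 𝔼(Xⁿ⁻¹, -)`, dual to `exists_push_dFirst_eq`. -/
theorem exists_pull_dLast_eq (hn : 0 < n) (hX : S.s δ = ⟦X⟧) (θ : Ext S.E (X.cx.X n) T)
    (hθ : pull (X.cx.d (n - 1) n) θ = 0) : ∃ θ' : Ext S.E C T, pull X.dLast θ' = θ := by
  obtain ⟨Z, hZ⟩ := S.exists_realization θ
  obtain ⟨D, ω, W, e, hW, he⟩ := S.deflation_comp Z.dLast X.dLast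
    ⟨T, θ, Z, Iso.refl _, hZ, by simp⟩ ⟨A, δ, X, Iso.refl _, hX, by simp⟩
  have he' : W.dLast = e.inv ≫ Z.dLast ≫ X.dLast := by
    rw [← he]; simp
  obtain ⟨a, ha⟩ := exists_push_eq hn hW δ (by
    rw [he', pull_comp, pull_comp, (S.isExangle δ X hX).pull_dLast, map_zero, map_zero])
  obtain ⟨f, hf, N, hN, hsN⟩ := S.good_lift_op ω a W X hW (by rw [ha, hX])
  have hfn : f.f n ≫ X.dLast = W.dLast := by
    have := hf.2
    rw [Category.comp_id] at this
    simp [Cpx.dLast, this]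
  have hk : ∃ k : W.cx.X n ⟶ X.cx.X (n - 1),
      k ≫ X.cx.d (n - 1) n = f.f n - e.inv ≫ Z.dLast := by
    have h0 : (f.f n - e.inv ≫ Z.dLast) ≫ X.cx.d n (n + 1) = 0 := by
      rw [← cancel_mono X.right.hom, Category.assoc]
      change _ ≫ X.dLast = _
      rw [Preadditive.sub_comp, hfn, he', Category.assoc, sub_self, zero_comp]
    obtain ⟨m, rfl⟩ : ∃ m, n = m + 1 := ⟨n - 1, by omega⟩
    exact (S.isExangle δ X hX).exact_mid m (by omega) _ _ h0
  obtain ⟨k, hk⟩ := hk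
  have hfθ : pull (f.f n) θ = 0 := by
    rw [← sub_add_cancel (f.f n) (e.inv ≫ Z.dLast), ← hk, pull_add, pull_comp, pull_comp, hθ,
      (S.isExangle θ Z hZ).pull_dLast, map_zero, map_zero, add_zero]
  obtain ⟨u, w, huw⟩ := hN.dLast_eq hn
  obtain ⟨t, ht⟩ := exists_push_eq hn hsN θ
    (by rw [huw, pull_add, pull_comp, pull_comp, hθ, hfθ, map_zero, map_zero, add_zero])
  exact ⟨push t ω, by rw [← push_pull, ht]⟩

end LongExact

/-! ### Functors with values in abelian groups -/

section Pointwise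

variable {𝒞 : Type u} [Category.{v} 𝒞] {G H : 𝒞ᵒᵖ ⥤ AddCommGrpCat.{v}}

theorem epi_of_surjective (φ : G ⟶ H)
    (h : ∀ {T : 𝒞} (z : H.obj (op T)), ∃ y, (φ.app (op T)).hom y = z) : Epi φ := by
  have : ∀ T, Epi (φ.app T) := fun T => (AddCommGrpCat.epi_iff_surjective _).2 fun z => h z
  exact NatTrans.epi_of_epi_app φ

theorem mono_of_injective (φ : G ⟶ H)
    (h : ∀ {T : 𝒞} (z : G.obj (op T)), (φ.app (op T)).hom z = 0 → z = 0) : Mono φ := by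
  have : ∀ T, Mono (φ.app T) := fun T => (AddCommGrpCat.mono_iff_injective _).2
    ((injective_iff_map_eq_zero (φ.app T).hom).2 fun z hz => h z hz)
  exact NatTrans.mono_of_mono_app φ

theorem exact_iff_forall_exists {K : ShortComplex (𝒞ᵒᵖ ⥤ AddCommGrpCat.{v})} :
    K.Exact ↔ ∀ {T : 𝒞} (z : K.X₂.obj (op T)), (K.g.app (op T)).hom z = 0 →
      ∃ y, (K.f.app (op T)).hom y = z := by
  have key (T : 𝒞ᵒᵖ) : IsZero (K.homology.obj T) ↔
      (K.map ((evaluation 𝒞ᵒᵖ AddCommGrpCat.{v}).obj T)).Exact := by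
    rw [ShortComplex.exact_iff_isZero_homology]
    exact (K.mapHomologyIso ((evaluation 𝒞ᵒᵖ AddCommGrpCat.{v}).obj T)).isZero_iff.symm
  rw [ShortComplex.exact_iff_isZero_homology, Functor.isZero_iff]
  simp only [key, ShortComplex.ab_exact_iff]
  exact ⟨fun h T z hz => h (op T) z hz, fun h T z hz => h (T := T.unop) z hz⟩

end Pointwise

/-! ### Functors presented by an extension -/

section Presentations

variable {𝒞 : Type u} [Category.{v} 𝒞] [Preadditive 𝒞] {A A' C D T T' : 𝒞}
  {G H : 𝒞ᵒᵖ ⥤ AddCommGrpCat.{v}}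

/-- The map `𝒞(T, C) ⟶ G(T)` given by a natural transformation `π : 𝒞(-, C) ⟶ G`. -/
def eval (π : preadditiveYoneda.obj C ⟶ G) : (T ⟶ C) →+ G.obj (op T) := (π.app (op T)).hom

theorem eval_zero (f : T ⟶ C) : eval (0 : preadditiveYoneda.obj C ⟶ G) f = 0 := rfl

theorem eval_comp (π : preadditiveYoneda.obj C ⟶ G) (φ : G ⟶ H) (f : T ⟶ C) :
    eval (π ≫ φ) f = (φ.app (op T)).hom (eval π f) := rfl

theorem eval_map_comp (c : C ⟶ D) (π : preadditiveYoneda.obj D ⟶ G) (f : T ⟶ C) :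
    eval (preadditiveYoneda.map c ≫ π) f = eval π (f ≫ c) := rfl

theorem map_eval (π : preadditiveYoneda.obj C ⟶ G) (u : T' ⟶ T) (f : T ⟶ C) :
    (G.map u.op).hom (eval π f) = eval π (u ≫ f) :=
  (ConcreteCategory.congr_hom (π.naturality u.op) f).symm

theorem eval_eq_map (π : preadditiveYoneda.obj C ⟶ G) (f : T ⟶ C) :
    eval π f = (G.map f.op).hom (eval π (𝟙 C)) := by
  rw [map_eval, Category.comp_id]

theorem eval_ext {π π' : preadditiveYoneda.obj C ⟶ G} (h : eval π (𝟙 C) = eval π' (𝟙 C)) :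
    π = π' := by
  have h' {T : 𝒞} (f : T ⟶ C) : eval π f = eval π' f := by
    rw [eval_eq_map, h, ← eval_eq_map]
  ext T f
  exact h' (T := T.unop) f

variable {E : 𝒞ᵒᵖ ⥤ 𝒞 ⥤ AddCommGrpCat.{v}}

/-- The natural transformation `π : 𝒞(-, C) ⟶ G` is surjective with kernel the annihilator of
`δ ∈ 𝔼(C, A)`. So `π` identifies `G` with the subfunctor of `𝔼(-, A)` generated by `δ`. -/
structure Presents (π : preadditiveYoneda.obj C ⟶ G) (δ : Ext E C A) : Prop where
  surjective : ∀ {T : 𝒞} (z : G.obj (op T)), ∃ f : T ⟶ C, eval π f = z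
  eval_eq_zero_iff : ∀ {T : 𝒞} (f : T ⟶ C), eval π f = 0 ↔ pull f δ = 0

variable {δ : Ext E C A} {ρ : Ext E D A'} {π : preadditiveYoneda.obj C ⟶ G}
  {π' : preadditiveYoneda.obj D ⟶ H}

theorem Presents.eval_eq_iff [E.Additive] (hπ : Presents π δ) (f g : T ⟶ C) :
    eval π f = eval π g ↔ pull f δ = pull g δ := by
  rw [← sub_eq_zero, ← map_sub, hπ.eval_eq_zero_iff, pull_sub, sub_eq_zero]

theorem Presents.exists_comp_eq (hπ' : Presents π' ρ) (π : preadditiveYoneda.obj C ⟶ H) :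
    ∃ c : C ⟶ D, π = preadditiveYoneda.map c ≫ π' := by
  obtain ⟨c, hc⟩ := hπ'.surjective (eval π (𝟙 C))
  exact ⟨c, eval_ext (by rw [eval_map_comp, Category.id_comp, hc])⟩

theorem Presents.comp_iso (hπ : Presents π δ) (e : G ≅ H) : Presents (π ≫ e.hom) δ where
  surjective z := by
    obtain ⟨f, hf⟩ := hπ.surjective ((e.inv.app _).hom z)
    refine ⟨f, ?_⟩
    rw [eval_comp, hf]
    exact ConcreteCategory.congr_hom (e.inv_hom_id_app _) z
  eval_eq_zero_iff {T} f := by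
    rw [← hπ.eval_eq_zero_iff, eval_comp]
    refine ⟨fun h => ?_, fun h => by rw [h, map_zero]⟩
    exact (ConcreteCategory.congr_hom (e.hom_inv_id_app (op T)) (eval π f)).symm.trans
      ((congrArg (e.inv.app (op T)).hom h).trans (map_zero _))

end Presentations

section Defects

variable {𝒞 : Type u} [Category.{v} 𝒞] [Preadditive 𝒞] [HasFiniteBiproducts 𝒞] {n : ℕ}
  {S : Exangulated n 𝒞} {A A' C D : 𝒞} {G H : 𝒞ᵒᵖ ⥤ AddCommGrpCat.{v}}
  {δ : Ext S.E C A} {ρ : Ext S.E D A'} {π : preadditiveYoneda.obj C ⟶ G}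
  {π' : preadditiveYoneda.obj D ⟶ H}

theorem Presents.exists_desc (hπ : Presents π δ) (ψ : preadditiveYoneda.obj C ⟶ H)
    (hψ : ∀ {T : 𝒞} (f : T ⟶ C), pull f δ = 0 → eval ψ f = 0) : ∃ φ : G ⟶ H, π ≫ φ = ψ := by
  obtain ⟨X, hX⟩ := S.exists_realization δ
  have hE := S.isExangle δ X hX
  let K : ShortComplex (𝒞ᵒᵖ ⥤ AddCommGrpCat.{v}) :=
    ShortComplex.mk (preadditiveYoneda.map X.dLast) π (eval_ext (by
      rw [eval_map_comp, Category.id_comp]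
      exact (hπ.eval_eq_zero_iff _).2 hE.pull_dLast))
  have hK : K.Exact := exact_iff_forall_exists.2 fun z hz =>
    hE.exact_right _ z ((hπ.eval_eq_zero_iff z).1 hz)
  have : Epi K.g := epi_of_surjective π hπ.surjective
  exact hK.desc' ψ (eval_ext (by
    rw [eval_map_comp, Category.id_comp]
    exact hψ _ hE.pull_dLast))

theorem Presents.nonempty_iso (hπ : Presents π δ) {π'' : preadditiveYoneda.obj C ⟶ H}
    (hπ' : Presents π'' δ) : Nonempty (G ≅ H) := by
  obtain ⟨φ, hφ⟩ := hπ.exists_desc π'' fun f hf => (hπ'.eval_eq_zero_iff f).2 hf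
  obtain ⟨ψ, hψ⟩ := hπ'.exists_desc π fun f hf => (hπ.eval_eq_zero_iff f).2 hf
  have : Epi π := epi_of_surjective π hπ.surjective
  have : Epi π'' := epi_of_surjective π'' hπ'.surjective
  exact ⟨φ, ψ, by rw [← cancel_epi π, reassoc_of% hφ, hψ, Category.comp_id],
    by rw [← cancel_epi π'', reassoc_of% hψ, hφ, Category.comp_id]⟩

theorem exists_presents_defect {X : Cpx n A C} (hX : S.s δ = ⟦X⟧) :
    ∃ π : preadditiveYoneda.obj C ⟶ defect X, Presents π δ := by
  have hE := S.isExangle δ X hX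
  let K : ShortComplex (𝒞ᵒᵖ ⥤ AddCommGrpCat.{v}) :=
    ShortComplex.mk (preadditiveYoneda.map X.dLast) (cokernel.π _) (cokernel.condition _)
  have hK : K.Exact := K.exact_of_g_is_cokernel (cokernelIsCokernel _)
  let π : preadditiveYoneda.obj C ⟶ defect X := K.g
  have h0 : preadditiveYoneda.map X.dLast ≫ π = 0 := K.zero
  refine ⟨π, ⟨fun {T} z => ?_, fun {T} f => ⟨fun h => ?_, fun h => ?_⟩⟩⟩
  · have : Epi ((cokernel.π (preadditiveYoneda.map X.dLast)).app (op T)) := inferInstance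
    exact (AddCommGrpCat.epi_iff_surjective _).1 this z
  · obtain ⟨g, hg⟩ : ∃ g : T ⟶ X.cx.X n, g ≫ X.dLast = f := exact_iff_forall_exists.1 hK f h
    rw [← hg, pull_comp, hE.pull_dLast, map_zero]
  · obtain ⟨g, rfl⟩ := hE.exact_right _ f h
    rw [← eval_map_comp, h0]
    rfl

theorem defectsOf_iff {F : Subbifunctor S.E} : defectsOf S F G ↔
    ∃ (A C : 𝒞) (δ : Ext S.E C A) (π : preadditiveYoneda.obj C ⟶ G),
      δ ∈ F.grp C A ∧ Presents π δ := by
  constructor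
  · rintro ⟨-, A, C, δ, X, hδ, hX, ⟨e⟩⟩
    obtain ⟨π, hπ⟩ := exists_presents_defect hX
    exact ⟨A, C, δ, _, hδ, hπ.comp_iso e.symm⟩
  · rintro ⟨A, C, δ, π, hδ, hπ⟩
    obtain ⟨X, hX⟩ := S.exists_realization δ
    obtain ⟨π', hπ'⟩ := exists_presents_defect hX
    obtain ⟨e⟩ := hπ.nonempty_iso hπ'
    exact ⟨⟨_, _, _, ⟨e⟩⟩, A, C, δ, X, hδ, hX, ⟨e⟩⟩

end Defects

/-! ### The category of defects -/

open scoped ZeroObject in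
theorem exact_of_isLimit_of_isColimit {𝒜 : Type*} [Category* 𝒜] [Preadditive 𝒜]
    [HasZeroObject 𝒜] {K : ShortComplex 𝒜} (hf : IsLimit (KernelFork.ofι K.f K.zero))
    (hg : IsColimit (CokernelCofork.ofπ K.g K.zero)) : K.Exact := by
  have hl : hf.lift (KernelFork.ofι _ K.zero) = 𝟙 _ :=
    Fork.IsLimit.hom_ext hf (by simp)
  have hr : hg.desc (CokernelCofork.ofπ _ K.zero) = 𝟙 _ :=
    Cofork.IsColimit.hom_ext hg (by simp)
  let L : K.LeftHomologyData :=
    { K := K.X₁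
      H := 0
      i := K.f
      π := 0
      wi := K.zero
      hi := hf
      wπ := comp_zero
      hπ := CokernelCofork.IsColimit.ofEpiOfIsZero _ (by rw [hl]; exact inferInstanceAs (Epi (𝟙 K.X₁)))
        (isZero_zero 𝒜) }
  let R : K.RightHomologyData :=
    { Q := K.X₃
      H := 0
      p := K.g
      ι := 0
      wp := K.zero
      hp := hg
      wι := zero_comp
      hι := KernelFork.IsLimit.ofMonoOfIsZero _ (by rw [hr]; exact inferInstanceAs (Mono (𝟙 K.X₃)))
        (isZero_zero 𝒜) }
  exact ⟨⟨L, R, Iso.refl _, by simp [L, R]⟩, isZero_zero 𝒜⟩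

section DefE

variable {𝒞 : Type u} [Category.{v} 𝒞] [Preadditive 𝒞] [HasFiniteBiproducts 𝒞] {n : ℕ}
  {S : Exangulated n 𝒞} {A B C D T : 𝒞} {G H : DefE S}
  {δ : Ext S.E C A} {ρ : Ext S.E D B} {π : preadditiveYoneda.obj C ⟶ G.obj}
  {π' : preadditiveYoneda.obj D ⟶ H.obj}

theorem exists_presentation (G : DefE S) : ∃ (A C : 𝒞) (δ : Ext S.E C A)
    (π : preadditiveYoneda.obj C ⟶ G.obj), Presents π δ := by
  obtain ⟨A, C, δ, π, -, h⟩ := defectsOf_iff.1 G.property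
  exact ⟨A, C, δ, π, h⟩

theorem exists_presents (δ : Ext S.E C A) :
    ∃ (G : DefE S) (π : preadditiveYoneda.obj C ⟶ G.obj), Presents π δ := by
  obtain ⟨X, hX⟩ := S.exists_realization δ
  obtain ⟨π, hπ⟩ := exists_presents_defect hX
  exact ⟨⟨defect X, defectsOf_iff.2 ⟨_, _, δ, π, trivial, hπ⟩⟩, π, hπ⟩

theorem Presents.exists_hom (hπ : Presents π δ) (ψ : preadditiveYoneda.obj C ⟶ H.obj)
    (hψ : ∀ {T : 𝒞} (f : T ⟶ C), pull f δ = 0 → eval ψ f = 0) :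
    ∃ φ : G ⟶ H, π ≫ φ.hom = ψ := by
  obtain ⟨φ, hφ⟩ := hπ.exists_desc ψ hψ
  exact ⟨ObjectProperty.homMk φ, hφ⟩

theorem Presents.hom_ext (hπ : Presents π δ) {φ φ' : G ⟶ H} (h : π ≫ φ.hom = π ≫ φ'.hom) :
    φ = φ' := by
  have : Epi π := epi_of_surjective π hπ.surjective
  exact ObjectProperty.hom_ext _ ((cancel_epi π).1 h)

theorem Presents.hom_eq_zero (hπ : Presents π δ) {φ : G ⟶ H}
    (h : eval (π ≫ φ.hom) (𝟙 C) = 0) : φ = 0 :=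
  hπ.hom_ext (eval_ext (h.trans (by rw [ObjectProperty.zero_hom, comp_zero, eval_zero])))

/-- The subfunctor generated by an element of `G` is again a defect. -/
theorem Presents.exists_sub (hπ : Presents π δ) (f : T ⟶ C) :
    ∃ (K : DefE S) (κ : preadditiveYoneda.obj T ⟶ K.obj) (k : K ⟶ G),
      Presents κ (pull f δ) ∧ κ ≫ k.hom = preadditiveYoneda.map f ≫ π := by
  obtain ⟨K, κ, hκ⟩ := exists_presents (pull f δ)
  obtain ⟨k, hk⟩ := hκ.exists_hom (preadditiveYoneda.map f ≫ π) fun g hg => by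
    rw [eval_map_comp, hπ.eval_eq_zero_iff, pull_comp, hg]
  exact ⟨K, κ, k, hκ, hk⟩

/-- A monomorphism of `def 𝔼` is injective: the subfunctor generated by an element of the
kernel belongs to `def 𝔼`. -/
theorem eq_zero_of_mono (φ : G ⟶ H) [Mono φ] (z : G.obj.obj (op T))
    (hz : (φ.hom.app (op T)).hom z = 0) : z = 0 := by
  obtain ⟨A, C, δ, π, hπ⟩ := exists_presentation G
  obtain ⟨f, rfl⟩ := hπ.surjective z
  obtain ⟨K, κ, k, hκ, hk⟩ := hπ.exists_sub f
  have h0 : k ≫ φ = 0 := hκ.hom_eq_zero (by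
    rw [ObjectProperty.FullSubcategory.comp_hom, reassoc_of% hk, eval_map_comp, eval_comp,
      Category.id_comp, hz])
  have hk0 : k = 0 := by rw [← cancel_mono φ, h0, zero_comp]
  rw [← Category.id_comp f, ← eval_map_comp, ← hk, hk0]
  rw [ObjectProperty.zero_hom, comp_zero, eval_zero]

/-- An epimorphism of `def 𝔼` is surjective: its image is generated by the image of a generator,
say `c^* ρ`, and its cokernel is the defect of `(d⁰)_* ρ`, where `d⁰` is the first differential of
a realization of `c^* ρ`. -/
theorem surjective_of_epi (hn : 0 < n) (φ : G ⟶ H) [Epi φ] (z : H.obj.obj (op T)) :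
    ∃ y, (φ.hom.app (op T)).hom y = z := by
  obtain ⟨A, C, δ, π, hπ⟩ := exists_presentation G
  obtain ⟨B, D, ρ, π', hπ'⟩ := exists_presentation H
  obtain ⟨c, hc⟩ := hπ'.exists_comp_eq (π ≫ φ.hom)
  obtain ⟨X, hX⟩ := S.exists_realization (pull c ρ)
  obtain ⟨L, l, hl⟩ := exists_presents (push X.dFirst ρ)
  obtain ⟨ψ, hψ⟩ := hπ'.exists_hom l fun f hf => by
    rw [hl.eval_eq_zero_iff, ← push_pull, hf, map_zero]
  have h0 : φ ≫ ψ = 0 := hπ.hom_eq_zero (by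
    rw [ObjectProperty.FullSubcategory.comp_hom, reassoc_of% hc, hψ, eval_map_comp,
      Category.id_comp, hl.eval_eq_zero_iff, ← push_pull, (S.isExangle _ X hX).push_dFirst])
  have hψ0 : ψ = 0 := by rw [← cancel_epi φ, h0, comp_zero]
  have hρ : push X.dFirst ρ = 0 := by
    rw [← pull_id (push X.dFirst ρ), ← hl.eval_eq_zero_iff, ← hψ, hψ0]
    rw [ObjectProperty.zero_hom, comp_zero, eval_zero]
  obtain ⟨t, ht⟩ := exists_pull_eq hn hX ρ hρ
  obtain ⟨f, rfl⟩ := hπ'.surjective z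
  refine ⟨eval π (f ≫ t), ?_⟩
  rw [← eval_comp, hc, eval_map_comp, hπ'.eval_eq_iff, Category.assoc, pull_comp, pull_comp, ht]

theorem balanced_defE (hn : 0 < n) : Balanced (DefE S) where
  isIso_of_mono_of_epi φ _ _ := by
    have : Mono φ.hom := mono_of_injective _ fun z hz => eq_zero_of_mono φ z hz
    have : Epi φ.hom := epi_of_surjective _ fun z => surjective_of_epi hn φ z
    rw [← ObjectProperty.isIso_hom_iff]
    exact isIso_of_mono_of_epi _

theorem exists_of_shortExact (hn : 0 < n) {K : ShortComplex (DefE S)} (hK : K.ShortExact)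
    (z : K.X₂.obj.obj (op T)) (hz : (K.g.hom.app (op T)).hom z = 0) :
    ∃ y, (K.f.hom.app (op T)).hom y = z := by
  have := balanced_defE (S := S) hn
  have := hK.mono_f
  obtain ⟨A, C, δ, π, hπ⟩ := exists_presentation K.X₂
  obtain ⟨f, rfl⟩ := hπ.surjective z
  obtain ⟨L, l, k, hl, hk⟩ := hπ.exists_sub f
  have h0 : k ≫ K.g = 0 := hl.hom_eq_zero (by
    rw [ObjectProperty.FullSubcategory.comp_hom, reassoc_of% hk, eval_map_comp, eval_comp,
      Category.id_comp, hz])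
  refine ⟨eval (l ≫ (hK.exact.lift k h0).hom) (𝟙 T), ?_⟩
  rw [← eval_comp, Category.assoc, ← ObjectProperty.FullSubcategory.comp_hom, hK.exact.lift_f, hk,
    eval_map_comp, Category.id_comp]

theorem Presents.isZero (hπ : Presents π (0 : Ext S.E C A)) : IsZero G :=
  (IsZero.iff_id_eq_zero G).2 (hπ.hom_eq_zero ((hπ.eval_eq_zero_iff _).2 (map_zero _)))

theorem hasZeroObject_defE : HasZeroObject (DefE S) := by
  obtain ⟨Z, -⟩ := HasZeroObject.zero (C := 𝒞)
  obtain ⟨G, π, hπ⟩ := exists_presents (0 : Ext S.E Z Z)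
  exact ⟨G, hπ.isZero⟩

theorem shortExact_of_pointwise (K : ShortComplex (DefE S))
    (hf : ∀ {T : 𝒞} (z : K.X₁.obj.obj (op T)), (K.f.hom.app (op T)).hom z = 0 → z = 0)
    (hg : ∀ {T : 𝒞} (z : K.X₃.obj.obj (op T)), ∃ y, (K.g.hom.app (op T)).hom y = z)
    (h : ∀ {T : 𝒞} (z : K.X₂.obj.obj (op T)), (K.g.hom.app (op T)).hom z = 0 →
      ∃ y, (K.f.hom.app (op T)).hom y = z) : K.ShortExact := by
  let ι := (defectsOf S ⊤).ι
  have h0 : K.f.hom ≫ K.g.hom = 0 := congrArg (·.hom) K.zero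
  let K' : ShortComplex (𝒞ᵒᵖ ⥤ AddCommGrpCat.{v}) := ShortComplex.mk K.f.hom K.g.hom h0
  have hK' : K'.Exact := exact_iff_forall_exists.2 h
  have hm : Mono K'.f := mono_of_injective _ hf
  have he : Epi K'.g := epi_of_surjective _ hg
  have hm' : Mono K.f := ι.mono_of_mono_map hm
  have he' : Epi K.g := ι.epi_of_epi_map he
  have := hasZeroObject_defE (S := S)
  refine ShortComplex.ShortExact.mk' (exact_of_isLimit_of_isColimit
    (KernelFork.IsLimit.ofι' _ _ fun {W} k hk => ?_)
    (CokernelCofork.IsColimit.ofπ' _ _ fun {W} k hk => ?_)) hm' he'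
  · have hk' : k.hom ≫ K'.g = 0 := congrArg (·.hom) hk
    exact ⟨ObjectProperty.homMk (hK'.lift k.hom hk'),
      ObjectProperty.hom_ext _ (hK'.lift_f k.hom hk')⟩
  · have hk' : K'.f ≫ k.hom = 0 := congrArg (·.hom) hk
    exact ⟨ObjectProperty.homMk (hK'.desc k.hom hk'),
      ObjectProperty.hom_ext _ (hK'.g_desc k.hom hk')⟩

end DefE

variable {𝒞 : Type u} [Category.{v} 𝒞] [Preadditive 𝒞] [HasFiniteBiproducts 𝒞] {n : ℕ}
  {S : Exangulated n 𝒞} {A B C D T : 𝒞} {G H : DefE S}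

/-! ### From closed subbifunctors to Serre subcategories -/

section Closed

variable {F F' : Subbifunctor S.E} {δ : Ext S.E C A} {π : preadditiveYoneda.obj C ⟶ G.obj}

/-- Membership in a subbifunctor is controlled by annihilators: if every morphism annihilating
`ρ` annihilates `δ`, then `δ` is a pushout of `ρ`. -/
theorem mem_of_pull_eq_zero (hn : 0 < n) {ρ : Ext S.E C B} (hρ : ρ ∈ F.grp C B)
    (h : ∀ {T : 𝒞} (f : T ⟶ C), pull f ρ = 0 → pull f δ = 0) : δ ∈ F.grp C A := by
  obtain ⟨Y, hY⟩ := S.exists_realization ρ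
  obtain ⟨a, rfl⟩ := exists_push_eq hn hY δ (h _ (S.isExangle ρ Y hY).pull_dLast)
  exact F.push_mem a hρ

theorem Presents.mem_of_injective (hn : 0 < n) (hπ : Presents π δ) (φ : G ⟶ H)
    (hφ : ∀ {T : 𝒞} (z : G.obj.obj (op T)), (φ.hom.app (op T)).hom z = 0 → z = 0)
    (hH : defectsIn S F H) : δ ∈ F.grp C A := by
  obtain ⟨B, D, ρ, π', hρ, hπ'⟩ := defectsOf_iff.1 hH
  obtain ⟨c, hc⟩ := hπ'.exists_comp_eq (π ≫ φ.hom)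
  refine mem_of_pull_eq_zero hn (F.pull_mem c hρ) fun f hf => ?_
  rw [← hπ.eval_eq_zero_iff]
  apply hφ
  rw [← eval_comp, hc, eval_map_comp, hπ'.eval_eq_zero_iff, pull_comp, hf]

theorem Presents.mem_of_surjective (hn : 0 < n) (hπ : Presents π δ) (φ : H ⟶ G)
    (hφ : ∀ {T : 𝒞} (z : G.obj.obj (op T)), ∃ y, (φ.hom.app (op T)).hom y = z)
    (hH : defectsIn S F H) : δ ∈ F.grp C A := by
  obtain ⟨B, D, ρ, π', hρ, hπ'⟩ := defectsOf_iff.1 hH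
  obtain ⟨c, hc⟩ := hπ.exists_comp_eq (π' ≫ φ.hom)
  have hcδ : pull c δ ∈ F.grp D A := mem_of_pull_eq_zero hn hρ fun f hf => by
    rw [← pull_comp, ← hπ.eval_eq_zero_iff, ← eval_map_comp, ← hc, eval_comp,
      (hπ'.eval_eq_zero_iff f).2 hf, map_zero]
  obtain ⟨y, hy⟩ := hφ (eval π (𝟙 C))
  obtain ⟨t, rfl⟩ := hπ'.surjective y
  rw [← eval_comp, hc, eval_map_comp, hπ.eval_eq_iff, pull_id, pull_comp] at hy
  exact hy ▸ F.pull_mem t hcδ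

/-- The defect of an extension decides whether the extension belongs to a subbifunctor. -/
theorem Presents.defectsIn_iff (hn : 0 < n) (hπ : Presents π δ) :
    defectsIn S F G ↔ δ ∈ F.grp C A :=
  ⟨hπ.mem_of_injective hn (𝟙 G) fun _ hz => hz, fun h => defectsOf_iff.2 ⟨_, _, δ, π, h, hπ⟩⟩

theorem le_iff_defectsIn_le (hn : 0 < n) : defectsIn S F ≤ defectsIn S F' ↔ F ≤ F' := by
  refine ⟨fun h C A δ hδ => ?_, fun h G hG => defectsOf_mono S h _ hG⟩
  obtain ⟨G, π, hπ⟩ := exists_presents δ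
  exact (hπ.defectsIn_iff hn).1 (h _ ((hπ.defectsIn_iff hn).2 hδ))

/-- If the subfunctor generated by `t^* δ` and the corresponding quotient are defects of `F`,
then `δ` belongs to `F`: by closedness `(d⁰)_* δ = (d⁰)_* θ` for some `θ` in `F`, and the
difference `δ - θ` is a pullback of `t^* δ`. -/
theorem mem_of_pull_mem_of_push_mem (hn : 0 < n) (hF : IsClosedRight S F) {t : T ⟶ C}
    {Z : Cpx n A T} (hZ : S.s (pull t δ) = ⟦Z⟧) (h₁ : pull t δ ∈ F.grp T A)
    (h₂ : push Z.dFirst δ ∈ F.grp C (Z.cx.X 1)) : δ ∈ F.grp C A := by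
  obtain ⟨θ, hθ, hθ'⟩ := (hF _ Z h₁ hZ C _ h₂).1 (by rw [← push_comp, Cpx.dFirst_d, push_zero])
  obtain ⟨u, hu⟩ := exists_pull_eq hn hZ (δ - θ) (by rw [map_sub, hθ', sub_self])
  rw [← sub_add_cancel δ θ, ← hu]
  exact add_mem (F.pull_mem u h₁) hθ

theorem isSerre_defectsIn (hn : 0 < n) (hF : IsClosedRight S F) : IsSerre (defectsIn S F) where
  containsZero := by
    obtain ⟨Z, -⟩ := HasZeroObject.zero (C := 𝒞)
    obtain ⟨G, π, hπ⟩ := exists_presents (0 : Ext S.E Z Z)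
    exact ⟨G, hπ.isZero, (hπ.defectsIn_iff hn).2 (zero_mem _)⟩
  subobjects := ⟨fun {G H} φ _ hH => by
    obtain ⟨A, C, δ, π, hπ⟩ := exists_presentation G
    exact (hπ.defectsIn_iff hn).2
      (hπ.mem_of_injective hn φ (fun z hz => eq_zero_of_mono φ z hz) hH)⟩
  quotients := ⟨fun {H G} φ _ hH => by
    obtain ⟨A, C, δ, π, hπ⟩ := exists_presentation G
    exact (hπ.defectsIn_iff hn).2
      (hπ.mem_of_surjective hn φ (fun z => surjective_of_epi hn φ z) hH)⟩
  extensions := ⟨fun {K} hK h₁ h₃ => by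
    have := hK.mono_f
    obtain ⟨A, C, δ, π, hπ⟩ := exists_presentation K.X₂
    obtain ⟨A₁, C₁, δ₁, π₁, hδ₁, hπ₁⟩ := defectsOf_iff.1 h₁
    obtain ⟨A₃, C₃, δ₃, π₃, hδ₃, hπ₃⟩ := defectsOf_iff.1 h₃
    obtain ⟨t, ht⟩ := hπ.exists_comp_eq (π₁ ≫ K.f.hom)
    obtain ⟨c, hc⟩ := hπ₃.exists_comp_eq (π ≫ K.g.hom)
    obtain ⟨Z, hZ⟩ := S.exists_realization (pull t δ)
    refine (hπ.defectsIn_iff hn).2 (mem_of_pull_mem_of_push_mem hn hF hZ ?_ ?_)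
    · refine mem_of_pull_eq_zero hn hδ₁ fun f hf => ?_
      rw [← pull_comp, ← hπ.eval_eq_zero_iff, ← eval_map_comp, ← ht, eval_comp,
        (hπ₁.eval_eq_zero_iff f).2 hf, map_zero]
    · refine mem_of_pull_eq_zero hn (F.pull_mem c hδ₃) fun f hf => ?_
      -- `f` represents an element of `K.X₂` which vanishes in `K.X₃`, so it comes from `K.X₁`
      obtain ⟨y, hy⟩ := exists_of_shortExact hn hK (eval π f) (by
        rw [← eval_comp, hc, eval_map_comp, hπ₃.eval_eq_zero_iff, pull_comp, hf])
      obtain ⟨w, rfl⟩ := hπ₁.surjective y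
      rw [← eval_comp, ht, eval_map_comp, hπ.eval_eq_iff, pull_comp] at hy
      rw [← push_pull, ← hy, push_pull, (S.isExangle _ Z hZ).push_dFirst, map_zero]⟩

end Closed

/-! ### From Serre subcategories to closed subbifunctors -/

section Serre

variable {P : ObjectProperty (DefE S)} {δ : Ext S.E C A}

/-- The defect of the extension `δ` belongs to `P`. -/
def HasDefectIn (P : ObjectProperty (DefE S)) (δ : Ext S.E C A) : Prop :=
  ∃ (G : DefE S) (π : preadditiveYoneda.obj C ⟶ G.obj), Presents π δ ∧ P G

theorem Presents.hasDefectIn_iff (hP : IsSerre P) {π : preadditiveYoneda.obj C ⟶ G.obj}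
    (hπ : Presents π δ) : HasDefectIn P δ ↔ P G := by
  refine ⟨fun ⟨H, π', hπ', hH⟩ => ?_, fun h => ⟨G, π, hπ, h⟩⟩
  have := hP.subobjects
  obtain ⟨e⟩ := hπ'.nonempty_iso hπ
  exact P.prop_of_iso ((defectsOf S ⊤).isoMk e) hH

theorem HasDefectIn.of_pull_eq_zero (hP : IsSerre P) (hδ : HasDefectIn P δ) {θ : Ext S.E C B}
    (h : ∀ {T : 𝒞} (f : T ⟶ C), pull f δ = 0 → pull f θ = 0) : HasDefectIn P θ := by
  have := hP.quotients
  obtain ⟨G, π, hπ, hG⟩ := hδ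
  obtain ⟨H, π', hπ'⟩ := exists_presents θ
  obtain ⟨φ, hφ⟩ := hπ.exists_hom π' fun f hf => (hπ'.eval_eq_zero_iff f).2 (h f hf)
  have : Epi φ := (defectsOf S ⊤).ι.epi_of_epi_map (epi_of_surjective φ.hom fun z => by
    obtain ⟨f, rfl⟩ := hπ'.surjective z
    exact ⟨eval π f, by rw [← eval_comp, hφ]⟩)
  exact ⟨H, π', hπ', P.prop_of_epi φ hG⟩

theorem HasDefectIn.push (hP : IsSerre P) (hδ : HasDefectIn P δ) (a : A ⟶ B) :
    HasDefectIn P (push a δ) :=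
  hδ.of_pull_eq_zero hP fun f hf => by rw [← push_pull, hf, map_zero]

theorem HasDefectIn.pull (hP : IsSerre P) (hδ : HasDefectIn P δ) (c : D ⟶ C) :
    HasDefectIn P (pull c δ) := by
  have := hP.subobjects
  obtain ⟨G, π, hπ, hG⟩ := hδ
  obtain ⟨K, κ, k, hκ, hk⟩ := hπ.exists_sub c
  have : Mono k := (defectsOf S ⊤).ι.mono_of_mono_map (mono_of_injective k.hom fun z hz => by
    obtain ⟨f, rfl⟩ := hκ.surjective z
    rw [← eval_comp, hk, eval_map_comp, hπ.eval_eq_zero_iff, pull_comp] at hz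
    exact (hκ.eval_eq_zero_iff f).2 hz)
  exact ⟨K, κ, hκ, P.prop_of_mono k hG⟩

/-- The defect of `δ` is an extension of the defect of `(d⁰)_* δ` by the defect of `t^* δ`, where
`d⁰` is the first differential of a realization of `t^* δ`. -/
theorem HasDefectIn.of_pull_of_push (hn : 0 < n) (hP : IsSerre P) {t : T ⟶ C}
    {Z : Cpx n A T} (hZ : S.s (NExact.pull t δ) = ⟦Z⟧) (h₁ : HasDefectIn P (NExact.pull t δ))
    (h₂ : HasDefectIn P (NExact.push Z.dFirst δ)) : HasDefectIn P δ := by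
  have := hP.extensions
  obtain ⟨G, π, hπ⟩ := exists_presents δ
  obtain ⟨K, κ, k, hκ, hk⟩ := hπ.exists_sub t
  obtain ⟨Q, π', hπ'⟩ := exists_presents (NExact.push Z.dFirst δ)
  obtain ⟨q, hq⟩ := hπ.exists_hom π' fun f hf => by
    rw [hπ'.eval_eq_zero_iff, ← push_pull, hf, map_zero]
  have h0 : k ≫ q = 0 := hκ.hom_eq_zero (by
    rw [ObjectProperty.FullSubcategory.comp_hom, reassoc_of% hk, hq, eval_map_comp,
      Category.id_comp, hπ'.eval_eq_zero_iff, ← push_pull, (S.isExangle _ Z hZ).push_dFirst])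
  refine ⟨G, π, hπ, P.prop_X₂_of_shortExact (shortExact_of_pointwise (ShortComplex.mk k q h0)
    (fun z hz => ?_) (fun z => ?_) fun z hz => ?_) ((hκ.hasDefectIn_iff hP).1 h₁)
    ((hπ'.hasDefectIn_iff hP).1 h₂)⟩
  · obtain ⟨f, rfl⟩ := hκ.surjective z
    rw [hκ.eval_eq_zero_iff, ← pull_comp, ← hπ.eval_eq_zero_iff, ← eval_map_comp, ← hk]
    exact hz
  · obtain ⟨f, rfl⟩ := hπ'.surjective z
    exact ⟨eval π f, by rw [← hq]; rfl⟩
  · obtain ⟨f, rfl⟩ := hπ.surjective z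
    have hf : eval π' f = 0 := by rw [← hq]; exact hz
    rw [hπ'.eval_eq_zero_iff, ← push_pull] at hf
    obtain ⟨w, hw⟩ := exists_pull_eq hn hZ _ hf
    rw [← pull_comp, ← hπ.eval_eq_iff, ← eval_map_comp, ← hk] at hw
    exact ⟨eval κ w, hw⟩

theorem HasDefectIn.add (hn : 0 < n) (hP : IsSerre P) {δ' : Ext S.E C A}
    (hδ : HasDefectIn P δ) (hδ' : HasDefectIn P δ') : HasDefectIn P (δ + δ') := by
  have := hasBinaryBiproducts_of_finite_biproducts 𝒞
  let η : Ext S.E (C ⊞ C) A := NExact.pull biprod.fst δ + NExact.pull biprod.snd δ'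
  have hl : NExact.pull biprod.inl η = δ := by
    simp [η, ← pull_comp, pull_id, pull_zero]
  have hd : NExact.pull (biprod.lift (𝟙 C) (𝟙 C)) η = δ + δ' := by
    simp [η, ← pull_comp, pull_id]
  obtain ⟨Z, hZ⟩ := S.exists_realization δ
  have hη : HasDefectIn P η := .of_pull_of_push hn hP (t := biprod.inl) (Z := Z)
    (by rw [hl, hZ]) (by rwa [hl]) (by
      simpa [η, push_pull, (S.isExangle δ Z hZ).push_dFirst] using
        (hδ'.push hP Z.dFirst).pull hP biprod.snd)
  exact hd ▸ hη.pull hP _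

/-- The subbifunctor of extensions with defect in a Serre subcategory. -/
def subbifunctorOfSerre (hn : 0 < n) (hP : IsSerre P) : Subbifunctor S.E where
  grp C A :=
    { carrier := {δ | HasDefectIn P δ}
      add_mem' := fun h h' => h.add hn hP h'
      zero_mem' := by
        have := hP.containsZero
        have := hP.subobjects
        obtain ⟨G, π, hπ⟩ := exists_presents (0 : Ext S.E C A)
        exact ⟨G, π, hπ, P.prop_of_isZero hπ.isZero⟩
      neg_mem' := fun h => h.of_pull_eq_zero hP fun f hf => by rw [map_neg, hf, neg_zero] }
  push_mem a _ h := HasDefectIn.push hP h a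
  pull_mem c _ h := HasDefectIn.pull hP h c

theorem isClosedRight_subbifunctorOfSerre (hn : 0 < n) (hP : IsSerre P) :
    IsClosedRight S (subbifunctorOfSerre hn hP) := by
  intro A C δ X hδ hX T θ hθ
  refine ⟨fun h => ?_, ?_⟩
  swap
  · rintro ⟨θ', -, rfl⟩
    rw [← push_comp, Cpx.dFirst_d, push_zero]
  obtain ⟨θ', rfl⟩ := exists_push_dFirst_eq hn hX θ h
  refine ⟨θ', ?_, rfl⟩
  have := hasBinaryBiproducts_of_finite_biproducts 𝒞
  -- `t` and `c` form a weak pullback of `θ'` and `δ`, so that `t^* θ' = c^* δ` generates the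
  -- intersection of the subfunctors generated by `θ'` and by `δ`
  let η : Ext S.E (T ⊞ C) A := pull biprod.fst θ' - pull biprod.snd δ
  obtain ⟨Z, hZ⟩ := S.exists_realization η
  have hE := S.isExangle η Z hZ
  let t := Z.dLast ≫ biprod.fst
  let c := Z.dLast ≫ biprod.snd
  have htc : pull t θ' = pull c δ := by
    have := hE.pull_dLast
    rwa [map_sub, ← pull_comp, ← pull_comp, sub_eq_zero] at this
  obtain ⟨W, hW⟩ := S.exists_realization (pull t θ')
  refine HasDefectIn.of_pull_of_push hn hP hW (htc ▸ HasDefectIn.pull hP hδ c)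
    (HasDefectIn.of_pull_eq_zero hP hθ fun f hf => ?_)
  rw [← push_pull] at hf
  obtain ⟨w, hw⟩ := exists_pull_eq hn hX _ hf
  obtain ⟨g, hg⟩ := hE.exact_right _ (biprod.lift f w) (by
    simp [η, ← pull_comp, hw])
  have hgf : f = g ≫ t := by
    rw [← Category.assoc, hg, biprod.lift_fst]
  rw [← push_pull, hgf, pull_comp, push_pull, (S.isExangle _ W hW).push_dFirst, map_zero]

theorem isClosedLeft_subbifunctorOfSerre (hn : 0 < n) (hP : IsSerre P) :
    IsClosedLeft S (subbifunctorOfSerre hn hP) := by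
  intro A C δ X hδ hX T θ hθ
  refine ⟨fun h => ?_, ?_⟩
  swap
  · rintro ⟨θ', -, rfl⟩
    rw [← pull_comp, Cpx.d_dLast, pull_zero]
  obtain ⟨θ', rfl⟩ := exists_pull_dLast_eq hn hX θ h
  refine ⟨θ', ?_, rfl⟩
  obtain ⟨W, hW⟩ := S.exists_realization (pull X.dLast θ')
  refine HasDefectIn.of_pull_of_push hn hP hW hθ ?_
  obtain ⟨a, ha⟩ := exists_push_eq hn hX (push W.dFirst θ') (by
    rw [← push_pull, (S.isExangle _ W hW).push_dFirst])
  exact ha ▸ HasDefectIn.push hP hδ a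

theorem defectsIn_subbifunctorOfSerre (hn : 0 < n) (hP : IsSerre P) :
    defectsIn S (subbifunctorOfSerre hn hP) = P := by
  ext G
  obtain ⟨A, C, δ, π, hπ⟩ := exists_presentation G
  exact (hπ.defectsIn_iff hn).trans (hπ.hasDefectIn_iff hP)

end Serre

end NExact

theorem theorem4p7 {𝒞 : Type u} [Category.{v} 𝒞] [Preadditive 𝒞] [HasFiniteBiproducts 𝒞]
    [EssentiallySmall.{v} 𝒞] [HasWeakKernels 𝒞] (n : ℕ) (hn : 0 < n)
    (S : NExact.Exangulated n 𝒞) :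
    ∃ Φ : NExact.ClosedSubbifunctor S ≃o NExact.SerreSubcategory (NExact.DefE S),
      ∀ F : NExact.ClosedSubbifunctor S, (Φ F).1 = NExact.defectsIn S F.1 := by
  let φ : NExact.ClosedSubbifunctor S ↪o NExact.SerreSubcategory (NExact.DefE S) :=
    OrderEmbedding.ofMapLEIff
      (fun F => ⟨NExact.defectsIn S F.1, NExact.isSerre_defectsIn hn F.2.1⟩)
      fun _ _ => NExact.le_iff_defectsIn_le hn
  refine ⟨RelIso.ofSurjective φ fun P => ⟨⟨NExact.subbifunctorOfSerre hn P.2,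
    NExact.isClosedRight_subbifunctorOfSerre hn P.2,
    NExact.isClosedLeft_subbifunctorOfSerre hn P.2⟩, ?_⟩, fun _ => rfl⟩
  exact Subtype.ext (NExact.defectsIn_subbifunctorOfSerre hn P.2)
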